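/- Let $D \subseteq \mathbb{C}$ be a domain (a non-empty connected open set) and let $\mathcal{F}$ be a family of holomorphic functions on $D$. Let $a, b \in \mathbb{C}$ with $b \neq a$ and $b \neq 0$, and let $K \subset \mathbb{C}$ be a compact (closed and bounded) set with $b \notin K$. Suppose that for every $f \in \mathcal{F}$ and every $z_0 \in D$, $$f(z_0) = a \Rightarrow f'(z_0) \in K \qquad\text{and}\qquad f(z_0) = b \Rightarrow f'(z_0) = b.$$ Then $\mathcal{F}$ is normal in $D$; that is, every sequence in $\mathcal{F}$ has a subsequence that converges locally uniformly on $D$ either to a holomorphic function or to $\infty$. -/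

import Mathlib

open Filter Topology

/-- The sequence `u` tends to `∞` locally uniformly on `D`: for each bound `M`, every point of
`D` has a neighbourhood in `D` on which all but finitely many `u n` exceed `M` in modulus. -/
def TendstoInftyLocallyUniformlyOn (u : ℕ → ℂ → ℂ) (D : Set ℂ) : Prop :=
  ∀ M : ℝ, ∀ z ∈ D, ∃ t ∈ 𝓝[D] z, ∀ᶠ n in atTop, ∀ w ∈ t, M < ‖u n w‖

/-- A family `F` of holomorphic functions on a domain `D` is normal (in the sense of Montel):
every sequence in `F` has a subsequence that converges locally uniformly on `D` either to a
holomorphic function or to `∞`. -/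
def IsNormalFamilyOn (F : Set (ℂ → ℂ)) (D : Set ℂ) : Prop :=
  ∀ u : ℕ → ℂ → ℂ, (∀ n, u n ∈ F) →
    ∃ φ : ℕ → ℕ, StrictMono φ ∧
      ((∃ g : ℂ → ℂ, DifferentiableOn ℂ g D ∧
          TendstoLocallyUniformlyOn (fun n => u (φ n)) g atTop D) ∨
        TendstoInftyLocallyUniformlyOn (fun n => u (φ n)) D)

/-! By Marty's criterion it suffices to bound the spherical derivative |f'|/(1 + |f|²) locally,
uniformly in f. If this fails, Zalcman rescaling gives v_n(ζ) = f_n(x_n + ρ_n ζ) with ρ_n → 0,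
spherical derivative 1 at 0 and at most 2 on discs exhausting the plane. Marty's criterion applies
to the v_n; the limit ∞ is excluded by the normalisation at 0, so a subsequence converges to an
entire g with spherical derivative 1 at 0 and at most 2 everywhere.

The hypotheses rescale to |v_n'| ≤ ρ_n B at a-points, where B bounds K, and v_n' = ρ_n b at
b-points. By Hurwitz, g' = 0 wherever g = a. At b-points the quotient (v_n' - ρ_n b)/(v_n - b) has
only removable singularities, and the maximum principle bounds it uniformly; in the limit |g'| ≤ C|g
- b| near a b-point, which would force g ≡ b. So g omits b.

Write g - b = (a - b)e^φ with φ entire. Where Re φ = 0, g is bounded, hence so is φ' = g'/(g - b).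
Schwarz–Pick and Hopf's lemma carry this bound to the whole plane, so φ is affine by Liouville. If φ
were not constant it would have a zero; there g = a, so φ' = 0, a contradiction. Thus g is constant,
against its spherical derivative 1 at 0. -/

/-! ### Arzelà–Ascoli and Hurwitz -/

/-- A sequence with values in a compact set which is eventually equicontinuous at each point of
`D` has a locally uniformly convergent subsequence. -/
theorem exists_subseq_tendstoLocallyUniformlyOn {X Y : Type*} [PseudoMetricSpace X]
    [SecondCountableTopology X] [MetricSpace Y] [CompleteSpace Y] {D : Set X} (hD : D.Nonempty)
    {C : Set Y} (hC : IsCompact C) {u : ℕ → X → Y} (hu : ∀ n x, u n x ∈ C)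
    (h : ∀ x ∈ D, ∀ ε > 0, ∃ t ∈ 𝓝[D] x, ∀ᶠ n in atTop, ∀ y ∈ t, dist (u n y) (u n x) < ε) :
    ∃ φ : ℕ → ℕ, StrictMono φ ∧ ∃ G : X → Y,
      TendstoLocallyUniformlyOn (fun n => u (φ n)) G atTop D := by
  have : Nonempty D := hD.to_subtype
  set Q : ℕ → D := TopologicalSpace.denseSeq D
  obtain ⟨l, -, φ, hφ, hl⟩ := (isCompact_univ_pi (fun _ : ℕ => hC)).tendsto_subseq
    (x := fun n k => u n (Q k)) (fun n k _ => hu n _)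
  rw [tendsto_pi_nhds] at hl
  have key : ∀ x ∈ D, ∀ ε > 0, ∃ t ∈ 𝓝[D] x, ∃ N, ∀ n ≥ N, ∀ m ≥ N, ∀ y ∈ t,
      dist (u (φ n) y) (u (φ m) y) < ε := by
    intro x hx ε hε
    -- The path from `u (φ n) y` to `u (φ m) y` has five legs: through x and a dense point `Q k` of
    -- t at index n, then back at index m.
    obtain ⟨t, ht, htn⟩ := h x hx (ε / 5) (by positivity)
    have ht' : ((↑) : D → X) ⁻¹' t ∈ 𝓝 (⟨x, hx⟩ : D) := by
      rw [nhds_subtype_eq_comap_nhdsWithin]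
      exact preimage_mem_comap ht
    obtain ⟨k, hk⟩ : ∃ k, ((Q k : D) : X) ∈ t := by
      obtain ⟨y, hy, k, rfl⟩ := mem_closure_iff_nhds.1
        ((TopologicalSpace.denseRange_denseSeq D) ⟨x, hx⟩) _ ht'
      exact ⟨k, hy⟩
    obtain ⟨N₁, hN₁⟩ := Metric.cauchySeq_iff.1 (hl k).cauchySeq (ε / 5) (by positivity)
    obtain ⟨N₂, hN₂⟩ := eventually_atTop.1 (hφ.tendsto_atTop.eventually htn)
    refine ⟨t, ht, max N₁ N₂, fun n hn m hm y hy => ?_⟩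
    have h1 := hN₁ n (le_of_max_le_left hn) m (le_of_max_le_left hm)
    have hn2 := hN₂ n (le_of_max_le_right hn)
    have hm2 := hN₂ m (le_of_max_le_right hm)
    have a1 := hn2 y hy
    have a2 := hn2 _ hk
    have a3 := hm2 y hy
    have a4 := hm2 _ hk
    rw [dist_comm] at a2 a3
    simp only [Function.comp_apply] at h1
    have t1 := dist_triangle (u (φ n) y) (u (φ n) x) (u (φ m) y)
    have t2 := dist_triangle (u (φ n) x) (u (φ n) (Q k)) (u (φ m) y)
    have t3 := dist_triangle (u (φ n) (Q k)) (u (φ m) (Q k)) (u (φ m) y)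
    have t4 := dist_triangle (u (φ m) (Q k)) (u (φ m) x) (u (φ m) y)
    linarith
  have hlim : ∀ x ∈ D, ∃ y, Tendsto (fun n => u (φ n) x) atTop (𝓝 y) := by
    refine fun x hx => cauchySeq_tendsto_of_complete (Metric.cauchySeq_iff.2 fun ε hε => ?_)
    obtain ⟨t, ht, N, hN⟩ := key x hx ε hε
    exact ⟨N, fun n hn m hm => hN n hn m hm x (mem_of_mem_nhdsWithin hx ht)⟩
  have : Nonempty Y := ⟨u 0 hD.some⟩
  choose! G hG using hlim
  refine ⟨φ, hφ, G, Metric.tendstoLocallyUniformlyOn_iff.2 fun ε hε x hx => ?_⟩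
  obtain ⟨t, ht, N, hN⟩ := key x hx (ε / 2) (by positivity)
  refine ⟨t ∩ D, inter_mem ht self_mem_nhdsWithin, ?_⟩
  filter_upwards [eventually_ge_atTop N] with n hn y hy
  refine lt_of_le_of_lt (le_of_tendsto ((hG y hy.2).dist tendsto_const_nhds) ?_) (half_lt_self hε)
  filter_upwards [eventually_ge_atTop N] with m hm using (hN m hm n hn y hy.1).le

/-- A limit of nowhere vanishing holomorphic functions which vanishes at a point vanishes near
this point. -/
theorem hurwitz_eventually_eq_zero {ι : Type*} {l : Filter ι} [l.NeBot] {h : ι → ℂ → ℂ} {g : ℂ → ℂ}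
    {U : Set ℂ} {z : ℂ} (hU : U ∈ 𝓝 z)
    (hh : ∀ᶠ n in l, ∀ w ∈ U, DifferentiableAt ℂ (h n) w ∧ h n w ≠ 0)
    (hlim : TendstoUniformlyOn h g l U) (hg : AnalyticAt ℂ g z) (hz : g z = 0) :
    ∀ᶠ w in 𝓝 z, g w = 0 := by
  refine (hg.eventually_eq_zero_or_eventually_ne_zero).resolve_right fun hne => ?_
  have hne' : ∀ᶠ w in 𝓝 z, (w ≠ z → g w ≠ 0) ∧ w ∈ U ∧ AnalyticAt ℂ g w :=
    (eventually_nhdsWithin_iff.1 hne).and ((show ∀ᶠ w in 𝓝 z, w ∈ U from hU).and hg.eventually_analyticAt)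
  obtain ⟨r, hr, hball⟩ := Metric.nhds_basis_closedBall.eventually_iff.1 hne'
  have hcont : ContinuousOn (fun w => ‖g w‖) (Metric.sphere z r) := fun w hw =>
    ((hball (Metric.sphere_subset_closedBall hw)).2.2.continuousAt.norm).continuousWithinAt
  obtain ⟨w₀, hw₀, hmin⟩ := (isCompact_sphere z r).exists_isMinOn
    (NormedSpace.sphere_nonempty.2 hr.le) hcont
  have hpos : 0 < ‖g w₀‖ := norm_pos_iff.2
    ((hball (Metric.sphere_subset_closedBall hw₀)).1 (Metric.ne_of_mem_sphere hw₀ hr.ne'))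
  obtain ⟨n, hn, hnu⟩ := (hh.and (Metric.tendstoUniformlyOn_iff.1 hlim (‖g w₀‖ / 2)
    (by positivity))).exists
  -- Maximum principle for 1/h n: on the circle |h n| is at least half the minimum of |g|, hence
  -- also at z, where h n is close to g z = 0.
  have hd : DiffContOnCl ℂ (fun w => (h n w)⁻¹) (Metric.ball z r) := by
    refine DifferentiableOn.diffContOnCl fun w hw => ?_
    rw [closure_ball z hr.ne'] at hw
    have := hn w (hball hw).2.1
    exact (this.1.inv this.2).differentiableWithinAt
  have hle : ‖(h n z)⁻¹‖ ≤ (‖g w₀‖ / 2)⁻¹ := by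
    refine Complex.norm_le_of_forall_mem_frontier_norm_le Metric.isBounded_ball hd (fun w hw => ?_)
      (subset_closure (Metric.mem_ball_self hr))
    rw [frontier_ball z hr.ne'] at hw
    have h1 := hnu w (hball (Metric.sphere_subset_closedBall hw)).2.1
    have h2 : ‖g w₀‖ ≤ ‖g w‖ := hmin hw
    rw [dist_eq_norm] at h1
    have h3 := norm_sub_norm_le (g w) (h n w)
    rw [norm_inv]
    exact inv_anti₀ (by positivity) (by linarith)
  have hzU : z ∈ U := mem_of_mem_nhds hU
  rw [norm_inv, inv_le_inv₀ (norm_pos_iff.2 (hn z hzU).2) (by positivity)] at hle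
  have := hnu z hzU
  rw [hz, dist_zero_left] at this
  linarith

/-! ### Stereographic coordinates and the spherical derivative -/

/-- The sphere coordinates `(1 / (1 + |w|²), w / (1 + |w|²))` of a point of the plane. -/
noncomputable def sphereCoord (w : ℂ) : ℝ × ℂ :=
  ((1 + ‖w‖ ^ 2)⁻¹, ((1 + ‖w‖ ^ 2)⁻¹ : ℝ) • w)

theorem sphereCoord_fst_pos (w : ℂ) : 0 < (sphereCoord w).1 := by
  simp only [sphereCoord]; positivity

theorem sphereCoord_norm_snd_sq (w : ℂ) :
    ‖(sphereCoord w).2‖ ^ 2 = (sphereCoord w).1 * (1 - (sphereCoord w).1) := by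
  simp only [sphereCoord, norm_smul, Real.norm_eq_abs]
  rw [abs_of_pos (by positivity)]
  field_simp
  ring

theorem eq_sphereCoord_snd_div_fst (w : ℂ) :
    w = (sphereCoord w).2 / ((sphereCoord w).1 : ℂ) := by
  have : ((sphereCoord w).1 : ℂ) ≠ 0 := mod_cast (sphereCoord_fst_pos w).ne'
  rw [eq_div_iff this]
  simp only [sphereCoord, Complex.real_smul]
  ring

/-- Chart at infinity: it turns convergence of sphere coordinates into convergence of reciprocals.
The convention 0⁻¹ = 0 matches the zero denominator at w = 0. -/
theorem inv_eq_conj_sphereCoord_div (w : ℂ) :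
    w⁻¹ = (starRingEnd ℂ) (sphereCoord w).2 / ((1 - (sphereCoord w).1 : ℝ) : ℂ) := by
  rcases eq_or_ne w 0 with rfl | hw
  · simp [sphereCoord]
  have h1 : (1 - (sphereCoord w).1) = ‖w‖ ^ 2 * (sphereCoord w).1 := by
    simp only [sphereCoord]; field_simp; ring
  have h2 : ((sphereCoord w).1 : ℂ) ≠ 0 := mod_cast (sphereCoord_fst_pos w).ne'
  have h3 : (starRingEnd ℂ) (sphereCoord w).2 =
      (starRingEnd ℂ) w * ((sphereCoord w).1 : ℂ) := by
    simp only [sphereCoord, Complex.real_smul, map_mul, Complex.conj_ofReal]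
    ring
  rw [h1, h3]
  push_cast
  rw [← Complex.mul_conj']
  have h4 : (starRingEnd ℂ) w ≠ 0 := by simpa using hw
  field_simp

theorem sphereCoord_mem (w : ℂ) :
    sphereCoord w ∈ Set.Icc (0 : ℝ) 1 ×ˢ Metric.closedBall (0 : ℂ) 1 := by
  have h0 := sphereCoord_fst_pos w
  have h1 : (sphereCoord w).1 ≤ 1 := by
    simp only [sphereCoord]
    exact inv_le_one_of_one_le₀ (by nlinarith [sq_nonneg ‖w‖])
  refine ⟨⟨h0.le, h1⟩, ?_⟩
  rw [mem_closedBall_zero_iff]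
  have := sphereCoord_norm_snd_sq w
  nlinarith [norm_nonneg (sphereCoord w).2]

/-- The first component contributes at most one unit of spherical speed, since 2x ≤ 1 + x². The
product rule gives the second at most 1 + 2, whence the constant 3. -/
theorem exists_hasDerivAt_sphereCoord {c : ℝ → ℂ} {c' : ℂ} {t : ℝ} (hc : HasDerivAt c c' t) :
    ∃ d, HasDerivAt (fun t => sphereCoord (c t)) d t ∧ ‖d‖ ≤ 3 * (‖c'‖ / (1 + ‖c t‖ ^ 2)) := by
  have hpos : 0 < 1 + ‖c t‖ ^ 2 := by positivity
  have h1 : HasDerivAt (fun t => (1 + ‖c t‖ ^ 2)⁻¹)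
      (-(2 * inner ℝ (c t) c') / (1 + ‖c t‖ ^ 2) ^ 2) t :=
    (hc.norm_sq.const_add 1).fun_inv hpos.ne'
  refine ⟨_, h1.prodMk (h1.smul hc), ?_⟩
  set x := ‖c t‖ with hx
  have hx0 : 0 ≤ x := norm_nonneg _
  have hy0 : 0 ≤ ‖c'‖ := norm_nonneg _
  have b1 : |(-(2 * inner ℝ (c t) c') / (1 + x ^ 2) ^ 2)| ≤ 2 * x * ‖c'‖ / (1 + x ^ 2) ^ 2 := by
    rw [abs_div, abs_neg, abs_mul, abs_two, abs_of_pos (by positivity : 0 < (1 + x ^ 2) ^ 2),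
      mul_assoc]
    gcongr
    exact abs_real_inner_le_norm (c t) c'
  have e1 : 2 * x * ‖c'‖ / (1 + x ^ 2) ^ 2 ≤ ‖c'‖ / (1 + x ^ 2) := by
    rw [div_le_div_iff₀ (by positivity) hpos]
    have : 2 * x ≤ 1 + x ^ 2 := by nlinarith [sq_nonneg (x - 1)]
    calc 2 * x * ‖c'‖ * (1 + x ^ 2) ≤ (1 + x ^ 2) * ‖c'‖ * (1 + x ^ 2) := by gcongr
      _ = _ := by ring
  have e2 : 2 * x * ‖c'‖ / (1 + x ^ 2) ^ 2 * x ≤ 2 * (‖c'‖ / (1 + x ^ 2)) := by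
    rw [div_mul_eq_mul_div, ← mul_div_assoc, div_le_div_iff₀ (by positivity) hpos]
    have : x * x ≤ 1 + x ^ 2 := by nlinarith
    calc 2 * x * ‖c'‖ * x * (1 + x ^ 2) = 2 * ‖c'‖ * (x * x) * (1 + x ^ 2) := by ring
      _ ≤ 2 * ‖c'‖ * (1 + x ^ 2) * (1 + x ^ 2) := by gcongr
      _ = _ := by ring
  have e0 : 0 ≤ ‖c'‖ / (1 + x ^ 2) := by positivity
  refine max_le ?_ ?_
  · rw [Real.norm_eq_abs]
    linarith
  · refine (norm_add_le _ _).trans ?_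
    rw [norm_smul, norm_smul, Real.norm_eq_abs, Real.norm_eq_abs, ← hx,
      abs_of_pos (inv_pos.2 hpos)]
    have := mul_le_mul_of_nonneg_right b1 hx0
    have e3 : (1 + x ^ 2)⁻¹ * ‖c'‖ = ‖c'‖ / (1 + x ^ 2) := by rw [div_eq_inv_mul]
    linarith

/-- A bound on the spherical derivative makes the sphere coordinates Lipschitz. -/
theorem dist_sphereCoord_le {f : ℂ → ℂ} {s : Set ℂ} (hs : Convex ℝ s) {M : ℝ}
    (hf : ∀ w ∈ s, DifferentiableAt ℂ f w ∧ ‖deriv f w‖ ≤ M * (1 + ‖f w‖ ^ 2))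
    {x y : ℂ} (hx : x ∈ s) (hy : y ∈ s) :
    dist (sphereCoord (f y)) (sphereCoord (f x)) ≤ 3 * M * ‖y - x‖ := by
  have hmem : ∀ t ∈ Set.Icc (0 : ℝ) 1, x + (t : ℂ) * (y - x) ∈ s := fun t ht => by
    have := hs.add_smul_sub_mem hx hy ht
    rwa [Complex.real_smul] at this
  have hc : ∀ t ∈ Set.Icc (0 : ℝ) 1, HasDerivAt (fun t : ℝ => f (x + (t : ℂ) * (y - x)))
      (deriv f (x + (t : ℂ) * (y - x)) * (y - x)) t := fun t ht => by
    have h1 : HasDerivAt (fun t : ℂ => x + t * (y - x)) (y - x) (t : ℂ) := by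
      simpa using ((hasDerivAt_id (t : ℂ)).mul_const (y - x)).const_add x
    exact (HasDerivAt.comp (t : ℂ) (hf _ (hmem t ht)).1.hasDerivAt h1).comp_ofReal
  choose! d hd hdn using fun t ht => exists_hasDerivAt_sphereCoord (hc t ht)
  have := norm_image_sub_le_of_norm_deriv_le_segment_01' (C := 3 * M * ‖y - x‖)
    (fun t ht => (hd t ht).hasDerivWithinAt)
    (fun t ht => by
      have ht' : t ∈ Set.Icc (0 : ℝ) 1 := Set.Ico_subset_Icc_self ht
      refine (hdn t ht').trans ?_
      rw [norm_mul, mul_assoc 3]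
      gcongr
      rw [div_le_iff₀ (by positivity)]
      have := mul_le_mul_of_nonneg_right (hf _ (hmem t ht')).2 (norm_nonneg (y - x))
      linarith)
  simpa [dist_eq_norm] using this

/-! ### Marty's criterion -/

/-- The sequence `u` is eventually holomorphic with bounded spherical derivative near each point
of `D`. -/
def HasLocallyBoundedSphericalDeriv (u : ℕ → ℂ → ℂ) (D : Set ℂ) : Prop :=
  ∀ z ∈ D, ∃ r > 0, ∃ M : ℝ, ∀ᶠ n in atTop, ∀ w ∈ Metric.ball z r,
    DifferentiableAt ℂ (u n) w ∧ ‖deriv (u n) w‖ ≤ M * (1 + ‖u n w‖ ^ 2)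

theorem HasLocallyBoundedSphericalDeriv.exists_subseq_sphereCoord {u : ℕ → ℂ → ℂ} {D : Set ℂ}
    (hu : HasLocallyBoundedSphericalDeriv u D) (hD : D.Nonempty) :
    ∃ φ : ℕ → ℕ, StrictMono φ ∧ ∃ G : ℂ → ℝ × ℂ,
      TendstoLocallyUniformlyOn (fun n z => sphereCoord (u (φ n) z)) G atTop D := by
  refine exists_subseq_tendstoLocallyUniformlyOn hD (u := fun n z => sphereCoord (u n z))
    (isCompact_Icc.prod (isCompact_closedBall (0 : ℂ) 1)) (fun n z => sphereCoord_mem _) ?_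
  intro z hz ε hε
  obtain ⟨r, hr, M, h⟩ := hu z hz
  have hM' : 0 < 3 * (|M| + 1) := by positivity
  refine ⟨Metric.ball z (min r (ε / (3 * (|M| + 1)))),
    mem_nhdsWithin_of_mem_nhds (Metric.ball_mem_nhds _ (by positivity)), ?_⟩
  filter_upwards [h] with n hn w hw
  have hw1 : w ∈ Metric.ball z r := Metric.ball_subset_ball (min_le_left _ _) hw
  have hw2 : ‖w - z‖ < ε / (3 * (|M| + 1)) := by
    have := Metric.ball_subset_ball (min_le_right _ _) hw
    rwa [Metric.mem_ball, dist_eq_norm] at this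
  refine (dist_sphereCoord_le (convex_ball z r) (M := |M| + 1) (fun y hy => ⟨(hn y hy).1,
    (hn y hy).2.trans ?_⟩) (Metric.mem_ball_self hr) hw1).trans_lt ?_
  · gcongr
    linarith [le_abs_self M]
  · rwa [lt_div_iff₀' hM'] at hw2

theorem HasLocallyBoundedSphericalDeriv.comp_strictMono {u : ℕ → ℂ → ℂ} {D : Set ℂ}
    (hu : HasLocallyBoundedSphericalDeriv u D) {φ : ℕ → ℕ} (hφ : StrictMono φ) :
    HasLocallyBoundedSphericalDeriv (fun n => u (φ n)) D := fun z hz => by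
  obtain ⟨r, hr, M, h⟩ := hu z hz
  exact ⟨r, hr, M, hφ.tendsto_atTop.eventually h⟩

section Limit

variable {u : ℕ → ℂ → ℂ} {D : Set ℂ} {G : ℂ → ℝ × ℂ}

theorem HasLocallyBoundedSphericalDeriv.continuousOn_limit
    (hu : HasLocallyBoundedSphericalDeriv u D) (hD : IsOpen D)
    (hG : TendstoLocallyUniformlyOn (fun n z => sphereCoord (u n z)) G atTop D) :
    ContinuousOn G D := by
  intro z hz
  obtain ⟨r, hr, M, h⟩ := hu z hz
  have hc : ContinuousOn G (D ∩ Metric.ball z r) := by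
    refine (hG.mono Set.inter_subset_left).continuousOn (Eventually.frequently ?_)
    filter_upwards [h] with n hn w hw
    have h1 : ContinuousAt (u n) w := (hn w hw.2).1.continuousAt
    have h2 : 1 + ‖u n w‖ ^ 2 ≠ 0 := by positivity
    have h3 : ContinuousAt (fun w => (1 + ‖u n w‖ ^ 2)⁻¹) w :=
      ((h1.norm.pow 2).const_add 1).inv₀ h2
    exact (h3.prodMk (h3.smul h1)).continuousWithinAt
  exact (hc.continuousAt ((hD.inter Metric.isOpen_ball).mem_nhds
    ⟨hz, Metric.mem_ball_self hr⟩)).continuousWithinAt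

theorem limit_norm_snd_sq
    (hG : TendstoLocallyUniformlyOn (fun n z => sphereCoord (u n z)) G atTop D) {z : ℂ}
    (hz : z ∈ D) : ‖(G z).2‖ ^ 2 = (G z).1 * (1 - (G z).1) := by
  have h := hG.tendsto_at hz
  have h1 := h.fst_nhds
  refine tendsto_nhds_unique (h.snd_nhds.norm.pow 2) ?_
  simp only [sphereCoord_norm_snd_sq]
  exact h1.mul (h1.const_sub 1)

theorem tendstoLocallyUniformlyOn_fst_snd {ι X : Type*} [TopologicalSpace X] {l : Filter ι}
    {F : ι → X → ℝ × ℂ} {f : X → ℝ × ℂ} {s : Set X} (h : TendstoLocallyUniformlyOn F f l s) :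
    TendstoLocallyUniformlyOn (fun n x => ((F n x).1 : ℂ)) (fun x => ((f x).1 : ℂ)) l s ∧
      TendstoLocallyUniformlyOn (fun n x => (F n x).2) (fun x => (f x).2) l s :=
  ⟨(Complex.isometry_ofReal.uniformContinuous.comp
    uniformContinuous_fst).comp_tendstoLocallyUniformlyOn h,
    uniformContinuous_snd.comp_tendstoLocallyUniformlyOn h⟩

/-- First coordinate 0 means the value ∞. Near such a point the reciprocals of `u n` are holomorphic
and zero-free, and their limit vanishes at z, so Hurwitz makes it vanish nearby. This yields the
open-and-closed dichotomy between finite and infinite limits. -/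
theorem HasLocallyBoundedSphericalDeriv.limit_eventually_fst_eq_zero
    (hu : HasLocallyBoundedSphericalDeriv u D) (hD : IsOpen D)
    (hG : TendstoLocallyUniformlyOn (fun n z => sphereCoord (u n z)) G atTop D) {z : ℂ}
    (hz : z ∈ D) (h0 : (G z).1 = 0) : ∀ᶠ w in 𝓝 z, (G w).1 = 0 := by
  have hc := hu.continuousOn_limit hD hG
  obtain ⟨r, hr, M, hd⟩ := hu z hz
  -- A zero of `u n` has first coordinate 1, more than 1/2 away from such a limit; the bound also
  -- keeps the denominator 1 - (G w).1 nonzero.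
  have hev : ∀ᶠ w in 𝓝 z, w ∈ D ∧ w ∈ Metric.ball z r ∧ (G w).1 < 1 / 2 := by
    refine (hD.eventually_mem hz).and ((Metric.isOpen_ball.eventually_mem (Metric.mem_ball_self hr)).and ?_)
    exact (hc.continuousAt (hD.mem_nhds hz)).fst.eventually (gt_mem_nhds (by simp only [h0]; norm_num))
  obtain ⟨ε, hε, hb⟩ := Metric.nhds_basis_closedBall.eventually_iff.1 hev
  set B := Metric.closedBall z ε
  have hBD : B ⊆ D := fun w hw => (hb hw).1
  have hBc : IsCompact B := isCompact_closedBall z ε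
  have hGB := hG.mono hBD
  have hunif := (tendstoLocallyUniformlyOn_iff_tendstoUniformlyOn_of_compact hBc).1 hGB
  have hne : ∀ᶠ n in atTop, ∀ w ∈ B, u n w ≠ 0 := by
    filter_upwards [Metric.tendstoUniformlyOn_iff.1 hunif (1 / 2) (by norm_num)] with n hn w hw h
    have h1 := (le_max_left _ _).trans_lt (hn w hw)
    have h2 := (hb hw).2.2
    simp only [h, sphereCoord] at h1
    rw [Real.dist_eq, abs_lt] at h1
    norm_num at h1
    linarith
  obtain ⟨hp, hs⟩ := tendstoLocallyUniformlyOn_fst_snd hGB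
  have hq : TendstoLocallyUniformlyOn (fun n w => ((1 - (sphereCoord (u n w)).1 : ℝ) : ℂ))
      (fun w => ((1 - (G w).1 : ℝ) : ℂ)) atTop B := by
    have : UniformContinuous (fun x : ℂ => 1 - x) := uniformContinuous_const.sub uniformContinuous_id
    simpa [Function.comp_def] using this.comp_tendstoLocallyUniformlyOn hp
  have hs' : TendstoLocallyUniformlyOn (fun n w => (starRingEnd ℂ) (sphereCoord (u n w)).2)
      (fun w => (starRingEnd ℂ) (G w).2) atTop B := by
    have : UniformContinuous (fun x : ℂ => (starRingEnd ℂ) x) :=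
      Complex.isometry_conj.uniformContinuous
    simpa [Function.comp_def] using this.comp_tendstoLocallyUniformlyOn hs
  have hcB := hc.mono hBD
  have hlim := hs'.fun_div₀ hq (Complex.continuous_conj.comp_continuousOn hcB.snd)
    (Complex.continuous_ofReal.comp_continuousOn (continuousOn_const.sub hcB.fst))
    (fun w hw => by
      have h1 : 1 - (G w).1 ≠ 0 := by linarith [(hb hw).2.2]
      exact_mod_cast h1)
  simp only [← inv_eq_conj_sphereCoord_div] at hlim
  have hBn : B ∈ 𝓝 z := Metric.closedBall_mem_nhds z hε
  have hdiff : ∀ᶠ n in atTop, ∀ w ∈ B, DifferentiableAt ℂ (fun w => (u n w)⁻¹) w ∧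
      (u n w)⁻¹ ≠ 0 := by
    filter_upwards [hne, hd] with n hn hn' w hw
    exact ⟨(hn' w (hb hw).2.1).1.inv (hn w hw), inv_ne_zero (hn w hw)⟩
  have han := (((hlim.mono Metric.ball_subset_closedBall).differentiableOn
    (hdiff.mono fun n hn w hw => (hn w
      (Metric.ball_subset_closedBall hw)).1.differentiableWithinAt) Metric.isOpen_ball).analyticAt
    (Metric.ball_mem_nhds z hε))
  have hz0 : (G z).2 = 0 := by
    have := limit_norm_snd_sq hG hz
    rw [h0, zero_mul] at this
    simpa using this
  filter_upwards [hurwitz_eventually_eq_zero hBn hdiff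
    ((tendstoLocallyUniformlyOn_iff_tendstoUniformlyOn_of_compact hBc).1 hlim) han
    (by simp [hz0]), hev] with w hw hw'
  have h1 : (1 - (G w).1) ≠ 0 := by linarith [hw'.2.2]
  have h2 : (G w).2 = 0 := by
    rcases div_eq_zero_iff.1 hw with h | h
    · simpa using h
    · exact absurd (by exact_mod_cast h) h1
  have h3 := limit_norm_snd_sq hG hw'.1
  rw [h2] at h3
  simpa [h1] using h3.symm

/-- **Marty's criterion**: a sequence with locally bounded spherical derivative has a subsequence
converging locally uniformly to a holomorphic function or to infinity. -/
theorem HasLocallyBoundedSphericalDeriv.exists_subseq (hu : HasLocallyBoundedSphericalDeriv u D)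
    (hD : IsOpen D) (hDc : IsConnected D) :
    ∃ φ : ℕ → ℕ, StrictMono φ ∧
      ((∃ g : ℂ → ℂ, DifferentiableOn ℂ g D ∧
          TendstoLocallyUniformlyOn (fun n => u (φ n)) g atTop D) ∨
        TendstoInftyLocallyUniformlyOn (fun n => u (φ n)) D) := by
  obtain ⟨φ, hφ, G, hG⟩ := hu.exists_subseq_sphereCoord hDc.nonempty
  refine ⟨φ, hφ, ?_⟩
  replace hu := hu.comp_strictMono hφ
  have hc := hu.continuousOn_limit hD hG
  have hdich : (∀ z ∈ D, (G z).1 = 0) ∨ (∀ z ∈ D, (G z).1 ≠ 0) := by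
    by_contra! hcon
    obtain ⟨⟨x, hx, hx0⟩, ⟨y, hy, hy0⟩⟩ := hcon
    have hne : ∀ z ∈ D, (G z).1 ≠ 0 → ∀ᶠ w in 𝓝 z, (G w).1 ≠ 0 := fun z hz h =>
      (hc.continuousAt (hD.mem_nhds hz)).fst.eventually_ne h
    obtain ⟨z, -, h1, h2⟩ := hDc.isPreconnected {z | ∀ᶠ w in 𝓝 z, (G w).1 = 0}
      {z | ∀ᶠ w in 𝓝 z, (G w).1 ≠ 0} isOpen_setOfPred_eventually_nhds isOpen_setOfPred_eventually_nhds
      (fun z hz => (eq_or_ne (G z).1 0).imp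
        (fun h => hu.limit_eventually_fst_eq_zero hD hG hz h) (hne z hz))
      ⟨y, hy, hu.limit_eventually_fst_eq_zero hD hG hy hy0⟩ ⟨x, hx, hne x hx hx0⟩
    exact h2.self_of_nhds h1.self_of_nhds
  rcases hdich with h0 | h0
  · right
    intro M z hz
    obtain ⟨t, ht, h⟩ := Metric.tendstoLocallyUniformlyOn_iff.1 hG (1 + M ^ 2)⁻¹ (by positivity) z hz
    refine ⟨t ∩ D, inter_mem ht self_mem_nhdsWithin, h.mono fun n hn w hw => ?_⟩
    have h1 := (le_max_left _ _).trans_lt (hn w hw.1)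
    rw [h0 w hw.2, dist_zero_left, Real.norm_eq_abs, abs_of_pos (sphereCoord_fst_pos _)] at h1
    rw [sphereCoord, inv_lt_inv₀ (by positivity) (by positivity)] at h1
    exact lt_of_abs_lt (abs_lt_of_sq_lt_sq (by linarith) (norm_nonneg _))
  · left
    obtain ⟨hp, hs⟩ := tendstoLocallyUniformlyOn_fst_snd hG
    have hlim := hs.fun_div₀ hp hc.snd (Complex.continuous_ofReal.comp_continuousOn hc.fst)
      (fun w hw => by exact_mod_cast h0 w hw)
    simp only [← eq_sphereCoord_snd_div_fst] at hlim
    refine ⟨_, fun z hz => ?_, hlim⟩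
    obtain ⟨r, hr, M, h⟩ := hu z hz
    refine (((hlim.mono Set.inter_subset_left).differentiableOn (h.mono fun n hn w hw =>
      (hn w hw.2).1.differentiableWithinAt) (hD.inter Metric.isOpen_ball)).differentiableAt
      ((hD.inter Metric.isOpen_ball).mem_nhds
      ⟨hz, Metric.mem_ball_self hr⟩)).differentiableWithinAt

end Limit

/-! ### Passing conditions at a-points and b-points to the limit -/

/-- Division of holomorphic functions when the denominator has only simple zeros. -/
theorem exists_differentiableOn_eq_mul {N F : ℂ → ℂ} {U : Set ℂ} (hU : IsOpen U)
    (hN : DifferentiableOn ℂ N U) (hF : DifferentiableOn ℂ F U)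
    (h : ∀ w ∈ U, F w = 0 → N w = 0 ∧ deriv F w ≠ 0) :
    ∃ Q : ℂ → ℂ, DifferentiableOn ℂ Q U ∧ ∀ w ∈ U, N w = Q w * F w := by
  classical
  refine ⟨fun w => if F w = 0 then deriv N w / deriv F w else N w / F w, fun w hw => ?_,
    fun w hw => ?_⟩
  · refine DifferentiableAt.differentiableWithinAt ?_
    have hUw := hU.mem_nhds hw
    by_cases h0 : F w = 0
    · have hdN := ((Complex.differentiableOn_dslope hUw).2 hN).differentiableAt hUw
      have hdF := ((Complex.differentiableOn_dslope hUw).2 hF).differentiableAt hUw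
      have hne : dslope F w w ≠ 0 := by rw [dslope_same]; exact (h w hw h0).2
      -- Near a zero of F the quotient is that of the divided differences, as the factor v - w
      -- cancels.
      refine (hdN.div hdF hne).congr_of_eventuallyEq ?_
      filter_upwards [hdF.continuousAt.eventually_ne hne] with v hv
      rcases eq_or_ne v w with rfl | hvw
      · simp [h0, dslope_same]
      · rw [dslope_of_ne _ hvw, slope_def_field, h0, sub_zero] at hv
        have hFv : F v ≠ 0 := fun h => hv (by simp [h])
        simp only [hFv, if_false, Pi.div_apply, dslope_of_ne _ hvw, slope_def_field, h0,
          (h w hw h0).1, sub_zero]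
        have := sub_ne_zero.2 hvw
        field_simp
    · refine ((hN.differentiableAt hUw).div (hF.differentiableAt hUw) h0).congr_of_eventuallyEq ?_
      filter_upwards [(hF.differentiableAt hUw).continuousAt.eventually_ne h0] with v hv
      simp [hv]
  · by_cases h0 : F w = 0
    · simp [h0, (h w hw h0).1]
    · simp [h0]

/-- Grönwall uniqueness along each segment issuing from z. -/
theorem eventually_eq_zero_of_norm_deriv_le {g : ℂ → ℂ} {z : ℂ} {r C : ℝ} (hr : 0 < r)
    (hg : ∀ w ∈ Metric.ball z r, DifferentiableAt ℂ g w ∧ ‖deriv g w‖ ≤ C * ‖g w‖)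
    (hz : g z = 0) : ∀ᶠ w in 𝓝 z, g w = 0 := by
  filter_upwards [Metric.ball_mem_nhds z hr] with w hw
  have hmem : ∀ t ∈ Set.Icc (0 : ℝ) 1, z + (t : ℂ) * (w - z) ∈ Metric.ball z r := fun t ht => by
    have := (convex_ball z r).add_smul_sub_mem (Metric.mem_ball_self hr) hw ht
    rwa [Complex.real_smul] at this
  have hc : ∀ t ∈ Set.Icc (0 : ℝ) 1, HasDerivAt (fun t : ℝ => g (z + (t : ℂ) * (w - z)))
      (deriv g (z + (t : ℂ) * (w - z)) * (w - z)) t := fun t ht => by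
    have h1 : HasDerivAt (fun t : ℂ => z + t * (w - z)) (w - z) (t : ℂ) := by
      simpa using ((hasDerivAt_id (t : ℂ)).mul_const (w - z)).const_add z
    exact (HasDerivAt.comp (t : ℂ) (hg _ (hmem t ht)).1.hasDerivAt h1).comp_ofReal
  have := eq_zero_of_abs_deriv_le_mul_abs_self_of_eq_zero_right (K := C * ‖w - z‖)
    (fun t ht => (hc t ht).continuousAt.continuousWithinAt)
    (fun t ht => (hc t (Set.Ico_subset_Icc_self ht)).hasDerivWithinAt) (by simp [hz])
    (fun t ht => by
      rw [norm_mul]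
      have := mul_le_mul_of_nonneg_right (hg _ (hmem t (Set.Ico_subset_Icc_self ht))).2
        (norm_nonneg (w - z))
      linarith) 1 (by simp)
  simpa using this

section Sharing

variable {u : ℕ → ℂ → ℂ} {g : ℂ → ℂ} {U : Set ℂ} {z : ℂ}

/-- If the derivatives of `u n` at the `b`-points of `u n` all equal the same nonzero constant
`c n` and `c n → 0`, then the limit of `u n` omits `b` or is locally constant equal to `b`. -/
theorem eventually_eq_of_deriv_eq_of_tendsto (hU : IsOpen U) (hz : z ∈ U)
    (hlim : TendstoLocallyUniformlyOn u g atTop U) (hu : ∀ᶠ n in atTop, DifferentiableOn ℂ (u n) U)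
    {b : ℂ} {c : ℕ → ℂ} (hc0 : ∀ n, c n ≠ 0) (hc : Tendsto c atTop (𝓝 0))
    (hb : ∀ᶠ n in atTop, ∀ w ∈ U, u n w = b → deriv (u n) w = c n) (hgz : g z = b) :
    ∀ᶠ w in 𝓝 z, g w = b := by
  have hgd := hlim.differentiableOn hu hU
  have hga : ∀ w ∈ U, AnalyticAt ℂ g w := fun w hw => hgd.analyticAt (hU.mem_nhds hw)
  have hlim' := hlim.deriv hu hU
  have hgb := (hga z hz).sub (analyticAt_const (v := b))
  by_contra hcon
  have hne := hgb.eventually_eq_zero_or_eventually_ne_zero.resolve_left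
    fun h => hcon (h.mono fun w hw => sub_eq_zero.1 hw)
  have hev : ∀ᶠ w in 𝓝 z, (w ≠ z → g w - b ≠ 0) ∧ w ∈ U :=
    (eventually_nhdsWithin_iff.1 hne).and (hU.eventually_mem hz)
  obtain ⟨r, hr, hball⟩ := Metric.nhds_basis_closedBall.eventually_iff.1 hev
  have hBU : Metric.closedBall z r ⊆ U := fun w hw => (hball hw).2
  have hSU : Metric.sphere z r ⊆ U := Metric.sphere_subset_closedBall.trans hBU
  have hS := isCompact_sphere z r
  have hSne := NormedSpace.sphere_nonempty (x := z).2 hr.le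
  obtain ⟨w₀, hw₀, hmin⟩ := hS.exists_isMinOn hSne
    ((hgd.continuousOn.mono hSU).sub (continuousOn_const (c := b))).norm
  obtain ⟨A, hA⟩ := hS.exists_bound_of_continuousOn
    ((fun w hw => (hga w (hSU hw)).deriv.continuousAt.continuousWithinAt :
      ContinuousOn (deriv g) (Metric.sphere z r)))
  set m := ‖g w₀ - b‖ with hm
  have hmpos : 0 < m := norm_pos_iff.2
    ((hball (Metric.sphere_subset_closedBall hw₀)).1 (Metric.ne_of_mem_sphere hw₀ hr.ne'))
  have hun := (tendstoLocallyUniformlyOn_iff_tendstoUniformlyOn_of_compact hS).1 (hlim.mono hSU)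
  have hun' := (tendstoLocallyUniformlyOn_iff_tendstoUniformlyOn_of_compact hS).1 (hlim'.mono hSU)
  -- The quotient is holomorphic because `c n ≠ 0` makes the b-points simple. On the circle its
  -- numerator is at most A + 1 + 1 (bound for g', approximation error, |c n|) and its denominator
  -- at least m/2.
  have hmain : ∀ᶠ n in atTop, ∀ w ∈ Metric.closedBall z r,
      ‖deriv (u n) w - c n‖ ≤ (A + 2) / (m / 2) * ‖u n w - b‖ := by
    filter_upwards [hu, hb, Metric.tendstoUniformlyOn_iff.1 hun (m / 2) (by positivity),
      Metric.tendstoUniformlyOn_iff.1 hun' 1 one_pos,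
      hc.norm.eventually (ge_mem_nhds (by simp : ‖(0 : ℂ)‖ < 1))] with n hn hbn h1 h2 h3 w hw
    obtain ⟨Q, hQ, hQe⟩ := exists_differentiableOn_eq_mul (N := fun w => deriv (u n) w - c n)
      (F := fun w => u n w - b) hU ((hn.deriv hU).sub_const _) (hn.sub_const _)
      (fun w hw h => by
        have := hbn w hw (sub_eq_zero.1 h)
        refine ⟨sub_eq_zero.2 this, ?_⟩
        rw [deriv_sub_const, this]
        exact hc0 n)
    have hQle : ‖Q w‖ ≤ (A + 2) / (m / 2) := by
      refine Complex.norm_le_of_forall_mem_frontier_norm_le (U := Metric.ball z r)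
        Metric.isBounded_ball (DifferentiableOn.diffContOnCl ?_) (fun v hv => ?_) ?_
      · rw [closure_ball z hr.ne']; exact hQ.mono hBU
      · rw [frontier_ball z hr.ne'] at hv
        have hv1 := h1 v hv
        have hv2 := h2 v hv
        have hv3 : m ≤ ‖g v - b‖ := hmin hv
        have hv4 := hA v hv
        rw [dist_eq_norm] at hv1 hv2
        simp only [Function.comp_apply] at hv2
        have h5 : m / 2 ≤ ‖u n v - b‖ := by
          have := norm_sub_norm_le (g v - b) (u n v - b)
          rw [sub_sub_sub_cancel_right] at this
          linarith
        have h6 : ‖deriv (u n) v - c n‖ ≤ A + 2 := by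
          have t1 := norm_sub_le (deriv (u n) v) (c n)
          have t2 := norm_sub_norm_le (deriv (u n) v) (deriv g v)
          rw [norm_sub_rev] at t2
          linarith
        have h7 := hQe v (hSU hv)
        rw [h7, norm_mul] at h6
        rw [le_div_iff₀ (by positivity)]
        refine le_trans ?_ h6
        gcongr
      · rwa [closure_ball z hr.ne']
    have := hQe w (hBU hw)
    rw [this, norm_mul]
    gcongr
  refine hcon ((eventually_eq_zero_of_norm_deriv_le (g := fun w => g w - b) (C := (A + 2) / (m / 2))
    hr (fun w hw => ?_) (by simp [hgz])).mono fun w hw => sub_eq_zero.1 hw)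
  have hwB := Metric.ball_subset_closedBall hw
  refine ⟨(hgd.differentiableAt (hU.mem_nhds (hBU hwB))).sub_const b, ?_⟩
  rw [deriv_sub_const]
  have t1 := (((hlim'.tendsto_at (hBU hwB)).sub hc)).norm
  have t2 := (((hlim.tendsto_at (hBU hwB)).sub_const b).norm.const_mul ((A + 2) / (m / 2)))
  rw [sub_zero] at t1
  exact le_of_tendsto_of_tendsto t1 t2 (hmain.mono fun n hn => hn w hwB)

/-- If the derivatives of `u n` at the `a`-points of `u n` are uniformly small, then the limit of
`u n` has vanishing derivative at its `a`-points. -/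
theorem deriv_eq_zero_of_norm_deriv_le_of_tendsto (hU : IsOpen U) (hz : z ∈ U)
    (hlim : TendstoLocallyUniformlyOn u g atTop U) (hu : ∀ᶠ n in atTop, DifferentiableOn ℂ (u n) U)
    {a : ℂ} {c : ℕ → ℝ} (hc : Tendsto c atTop (𝓝 0))
    (ha : ∀ᶠ n in atTop, ∀ w ∈ U, u n w = a → ‖deriv (u n) w‖ ≤ c n) (hgz : g z = a) :
    deriv g z = 0 := by
  have hgd := hlim.differentiableOn hu hU
  have hga : AnalyticAt ℂ g z := hgd.analyticAt (hU.mem_nhds hz)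
  have hlim' := hlim.deriv hu hU
  by_contra hd
  have hδ : 0 < ‖deriv g z‖ / 2 := by positivity
  have hev : ∀ᶠ w in 𝓝 z, ‖deriv g z‖ / 2 < ‖deriv g w‖ ∧ w ∈ U :=
    (hga.deriv.continuousAt.norm.eventually (lt_mem_nhds (by linarith))).and (hU.eventually_mem hz)
  obtain ⟨r, hr, hball⟩ := Metric.nhds_basis_closedBall.eventually_iff.1 hev
  have hBU : Metric.closedBall z r ⊆ U := fun w hw => (hball hw).2
  have hB := isCompact_closedBall z r
  have hun := (tendstoLocallyUniformlyOn_iff_tendstoUniformlyOn_of_compact hB).1 (hlim.mono hBU)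
  have hun' := (tendstoLocallyUniformlyOn_iff_tendstoUniformlyOn_of_compact hB).1 (hlim'.mono hBU)
  have hne : ∀ᶠ n in atTop, ∀ w ∈ Metric.closedBall z r,
      DifferentiableAt ℂ (fun w => u n w - a) w ∧ u n w - a ≠ 0 := by
    -- On the disc |g'| > |g'(z)|/2, so |(u n)'| > |g'(z)|/4 > c n, which leaves no a-points there.
    filter_upwards [hu, ha, Metric.tendstoUniformlyOn_iff.1 hun' (‖deriv g z‖ / 4) (by positivity),
      hc.eventually (gt_mem_nhds (by positivity : 0 < ‖deriv g z‖ / 4))] with n hn han h1 h2 w hw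
    refine ⟨(hn.differentiableAt (hU.mem_nhds (hBU hw))).sub_const a, fun h => ?_⟩
    have h3 := han w (hBU hw) (sub_eq_zero.1 h)
    have h4 := h1 w hw
    have h5 := (hball hw).1
    rw [dist_eq_norm] at h4
    simp only [Function.comp_apply] at h4
    have := norm_sub_norm_le (deriv g w) (deriv (u n) w)
    linarith
  have hun0 : TendstoUniformlyOn (fun n w => u n w - a) (fun w => g w - a) atTop
      (Metric.closedBall z r) := by
    simpa [Metric.tendstoUniformlyOn_iff, dist_eq_norm] using Metric.tendstoUniformlyOn_iff.1 hun
  have h0 := hurwitz_eventually_eq_zero (Metric.closedBall_mem_nhds z hr) hne hun0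
    (hga.sub analyticAt_const) (by simp [hgz])
  have : g =ᶠ[𝓝 z] fun _ => a := h0.mono fun w hw => sub_eq_zero.1 hw
  exact hd (by rw [this.deriv_eq, deriv_const])

end Sharing

/-! ### Holomorphic functions with positive real part -/

section HalfPlane

variable {φ : ℂ → ℂ} {z : ℂ} {d : ℝ}

/-- The Cayley transform of a holomorphic function with positive real part, centred at `z`. -/
theorem mapsTo_cayley (hpos : ∀ w ∈ Metric.ball z d, 0 < (φ w).re) (hz : 0 < (φ z).re) :
    Set.MapsTo (fun w => (φ w - φ z) / (φ w + (starRingEnd ℂ) (φ z))) (Metric.ball z d)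
      (Metric.closedBall ((φ z - φ z) / (φ z + (starRingEnd ℂ) (φ z))) 1) := by
  intro w hw
  rw [sub_self, zero_div, mem_closedBall_zero_iff, norm_div]
  refine div_le_one_of_le₀ ?_ (norm_nonneg _)
  -- The squared moduli of denominator and numerator differ by 4 Re φ(w) Re φ(z).
  rw [← sq_le_sq₀ (norm_nonneg _) (norm_nonneg _), Complex.sq_norm, Complex.sq_norm,
    Complex.normSq_apply, Complex.normSq_apply]
  have := mul_pos (hpos w hw) hz
  simp only [Complex.sub_re, Complex.sub_im, Complex.add_re, Complex.add_im, Complex.conj_re,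
    Complex.conj_im]
  nlinarith

theorem add_conj_ne_zero_of_re_pos {x y : ℂ} (hx : 0 < x.re) (hy : 0 < y.re) :
    x + (starRingEnd ℂ) y ≠ 0 := fun h => by
  have := congrArg Complex.re h
  simp at this
  linarith

theorem differentiableOn_cayley (hφ : DifferentiableOn ℂ φ (Metric.ball z d))
    (hpos : ∀ w ∈ Metric.ball z d, 0 < (φ w).re) (hz : 0 < (φ z).re) :
    DifferentiableOn ℂ (fun w => (φ w - φ z) / (φ w + (starRingEnd ℂ) (φ z))) (Metric.ball z d) :=
  (hφ.sub_const _).div (hφ.add_const _) fun w hw => add_conj_ne_zero_of_re_pos (hpos w hw) hz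

/-- Schwarz–Pick derivative bound for functions with positive real part. -/
theorem norm_deriv_le_of_re_pos (hd : 0 < d) (hφ : DifferentiableOn ℂ φ (Metric.ball z d))
    (hpos : ∀ w ∈ Metric.ball z d, 0 < (φ w).re) : ‖deriv φ z‖ ≤ 2 * (φ z).re / d := by
  have hz := hpos z (Metric.mem_ball_self hd)
  have h := Complex.norm_deriv_le_div_of_mapsTo_ball (differentiableOn_cayley hφ hpos hz)
    (mapsTo_cayley hpos hz) hd
  have hφz : HasDerivAt φ (deriv φ z) z :=
    (hφ.differentiableAt (Metric.ball_mem_nhds z hd)).hasDerivAt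
  have hne := add_conj_ne_zero_of_re_pos hz hz
  have hder := (hφz.sub_const (φ z)).fun_div (hφz.add_const ((starRingEnd ℂ) (φ z))) hne
  rw [hder.deriv, sub_self, zero_mul, sub_zero, sq, mul_div_mul_right _ _ hne, norm_div,
    Complex.add_conj, Complex.norm_real, Real.norm_of_nonneg (by linarith),
    div_le_iff₀ (by linarith)] at h
  rw [div_mul_eq_mul_div, one_mul] at h
  exact h

/-- Harnack's inequality. -/
theorem re_ge_of_re_pos (hφ : DifferentiableOn ℂ φ (Metric.ball z d))
    (hpos : ∀ w ∈ Metric.ball z d, 0 < (φ w).re) {w : ℂ} (hw : w ∈ Metric.ball z d) :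
    (φ z).re * (d - dist w z) ≤ (φ w).re * (d + dist w z) := by
  have hd : 0 < d := Metric.nonempty_ball.1 ⟨w, hw⟩
  have hz := hpos z (Metric.mem_ball_self hd)
  have hx := hpos w hw
  have h := Complex.dist_le_div_mul_dist_of_mapsTo_ball (differentiableOn_cayley hφ hpos hz)
    (mapsTo_cayley hpos hz) hw
  have hs : dist w z < d := hw
  rw [sub_self, zero_div, dist_zero_right, norm_div,
    div_le_iff₀ (norm_pos_iff.2 (add_conj_ne_zero_of_re_pos hx hz))] at h
  set s := dist w z
  have hs0 : 0 ≤ s := dist_nonneg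
  have h1 : d * ‖φ w - φ z‖ ≤ s * ‖φ w + (starRingEnd ℂ) (φ z)‖ := by
    have := mul_le_mul_of_nonneg_left h hd.le
    calc _ ≤ _ := this
      _ = _ := by field_simp
  rw [← sq_le_sq₀ (by positivity) (by positivity), mul_pow, mul_pow, Complex.sq_norm,
    Complex.sq_norm, Complex.normSq_apply, Complex.normSq_apply] at h1
  simp only [Complex.sub_re, Complex.sub_im, Complex.add_re, Complex.add_im, Complex.conj_re,
    Complex.conj_im] at h1
  set x := (φ w).re
  set A := (φ z).re
  set Y := (φ w).im - (φ z).im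
  have h2 : (d * (A - x)) ^ 2 ≤ (s * (x + A)) ^ 2 := by
    have : s ^ 2 * Y ^ 2 ≤ d ^ 2 * Y ^ 2 := by gcongr
    rw [← sub_eq_add_neg] at h1
    nlinarith
  have h3 := abs_le_of_sq_le_sq' h2 (by positivity)
  nlinarith [h3.2]

/-- A quantitative form of Hopf's lemma. -/
theorem re_le_of_re_eq_zero_of_norm_deriv_le {w : ℂ} {C : ℝ} (hd : 0 < d)
    (hφ : Differentiable ℂ φ) (hpos : ∀ w ∈ Metric.ball z d, 0 < (φ w).re)
    (hw : dist w z = d) (hw0 : (φ w).re = 0) (hC : ‖deriv φ w‖ ≤ C) :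
    (φ z).re ≤ 2 * (C * d) := by
  have h1 : HasDerivAt (fun t : ℂ => z + t * (w - z)) (w - z) ((1 : ℝ) : ℂ) := by
    simpa using ((hasDerivAt_id ((1 : ℝ) : ℂ)).mul_const (w - z)).const_add z
  have hwe : z + ((1 : ℝ) : ℂ) * (w - z) = w := by push_cast; ring
  have h2 : HasDerivAt φ (deriv φ w) (z + ((1 : ℝ) : ℂ) * (w - z)) := by
    rw [hwe]; exact (hφ w).hasDerivAt
  have h3 := (HasDerivAt.comp ((1 : ℝ) : ℂ) h2 h1).real_of_complex
  have h4 := (hasDerivWithinAt_iff_tendsto_slope' (s := Set.Iio (1 : ℝ)) (by simp)).1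
    h3.hasDerivWithinAt
  -- Harnack at distance td from z gives Re φ ≥ Re φ(z)(1 - t)/(1 + t), so the radial difference
  -- quotients at w are at most -Re φ(z)/2.
  have h5 : (deriv φ w * (w - z)).re ≤ -((φ z).re / 2) := by
    refine le_of_tendsto h4 ?_
    filter_upwards [Ioo_mem_nhdsLT (zero_lt_one' ℝ)] with t ht
    have hdist : dist (z + (t : ℂ) * (w - z)) z = t * d := by
      rw [dist_eq_norm, add_sub_cancel_left, norm_mul, ← dist_eq_norm, hw, Complex.norm_real,
        Real.norm_of_nonneg ht.1.le]
    have hmem : z + (t : ℂ) * (w - z) ∈ Metric.ball z d := by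
      rw [Metric.mem_ball, hdist]; nlinarith [ht.2]
    have h6 := re_ge_of_re_pos hφ.differentiableOn hpos hmem
    have h7 := hpos _ hmem
    have h8 := hpos z (Metric.mem_ball_self hd)
    rw [hdist] at h6
    have h9 : (φ z).re * (1 - t) ≤ (φ (z + (t : ℂ) * (w - z))).re * 2 := by
      have : (φ z).re * (1 - t) ≤ (φ (z + (t : ℂ) * (w - z))).re * (1 + t) := by
        refine le_of_mul_le_mul_right ?_ hd
        linarith
      nlinarith [ht.2]
    simp only [slope_def_field, Function.comp_apply]
    rw [hwe, hw0, sub_zero, div_le_iff_of_neg (by linarith [ht.2])]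
    linarith
  have h6 : ‖deriv φ w * (w - z)‖ ≤ C * d := by
    rw [norm_mul, ← dist_eq_norm, hw]
    gcongr
  have := (abs_le.1 (Complex.abs_re_le_norm (deriv φ w * (w - z)))).1
  linarith

/-- On the largest disc about z with Re φ > 0, of radius d, Schwarz–Pick gives |φ'(z)| ≤ 2 Re
φ(z)/d, and Hopf at a boundary zero of Re φ gives Re φ(z) ≤ 2Cd. If Re φ has no zeros, d → ∞ gives
φ'(z) = 0. -/
theorem norm_deriv_le_of_norm_deriv_le_of_re_eq_zero {C : ℝ} (hφ : Differentiable ℂ φ)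
    (hC : ∀ w, (φ w).re = 0 → ‖deriv φ w‖ ≤ C) (hC0 : 0 ≤ C) (hz : 0 < (φ z).re) :
    ‖deriv φ z‖ ≤ 4 * C := by
  have hcont : Continuous fun w => (φ w).re := Complex.continuous_re.comp hφ.continuous
  have hball : ∀ d, (∀ w ∈ Metric.ball z d, (φ w).re ≠ 0) →
      ∀ w ∈ Metric.ball z d, 0 < (φ w).re := by
    intro d h w hw
    by_contra! hle
    have hd : 0 < d := Metric.nonempty_ball.1 ⟨w, hw⟩
    obtain ⟨v, hv, hv0⟩ := (convex_ball z d).isPreconnected.intermediate_value hw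
      (Metric.mem_ball_self hd) hcont.continuousOn ⟨hle, hz.le⟩
    exact h v hv hv0
  rcases Set.eq_empty_or_nonempty {w | (φ w).re = 0} with hS | hS
  · have h0 : ∀ d > 0, ‖deriv φ z‖ ≤ 2 * (φ z).re / d := fun d hd =>
      norm_deriv_le_of_re_pos hd hφ.differentiableOn
        (hball d fun w _ hw => by simpa [hS] using (show w ∈ {w | (φ w).re = 0} from hw))
    have := ge_of_tendsto (tendsto_const_nhds.div_atTop tendsto_id)
      ((eventually_gt_atTop 0).mono h0)
    linarith
  · have hclosed : IsClosed {w | (φ w).re = 0} := isClosed_eq hcont continuous_const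
    obtain ⟨w, hw, hwd⟩ := hclosed.exists_infDist_eq_dist hS z
    have hw0 : (φ w).re = 0 := hw
    have hd : 0 < dist w z := by
      rw [dist_pos]
      rintro rfl
      exact hz.ne' hw0
    have hpos := hball (dist w z) fun v hv hv0 => by
      have h1 : Metric.infDist z {w | (φ w).re = 0} ≤ dist z v := Metric.infDist_le_dist_of_mem hv0
      rw [hwd, dist_comm z w, dist_comm z v] at h1
      exact absurd (Metric.mem_ball.1 hv) (not_lt.2 h1)
    have h1 := re_le_of_re_eq_zero_of_norm_deriv_le hd hφ hpos rfl hw0 (hC w hw0)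
    have h2 := norm_deriv_le_of_re_pos hd hφ.differentiableOn hpos
    refine h2.trans ?_
    rw [div_le_iff₀ hd]
    linarith

end HalfPlane

/-! ### Rigidity of entire functions -/

/-- An entire function whose derivative is bounded on the zero set of its real part and vanishes
at its zeros is constant. -/
theorem deriv_eq_zero_of_norm_deriv_le_of_re_eq_zero {φ : ℂ → ℂ} {C : ℝ} (hφ : Differentiable ℂ φ)
    (hC : ∀ w, (φ w).re = 0 → ‖deriv φ w‖ ≤ C) (hC0 : 0 ≤ C)
    (h0 : ∀ w, φ w = 0 → deriv φ w = 0) (z : ℂ) : deriv φ z = 0 := by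
  have hbd : ∀ z, ‖deriv φ z‖ ≤ 4 * C := by
    intro z
    rcases lt_trichotomy (φ z).re 0 with h | h | h
    · have := norm_deriv_le_of_norm_deriv_le_of_re_eq_zero (φ := fun w => -φ w) (z := z) hφ.neg
        (C := C) (fun w hw => by
          rw [deriv.fun_neg, norm_neg]
          exact hC w (by simpa using hw)) hC0 (by simpa using h)
      rwa [deriv.fun_neg, norm_neg] at this
    · linarith [hC z h]
    · exact norm_deriv_le_of_norm_deriv_le_of_re_eq_zero hφ hC hC0 h
  have hφ' : Differentiable ℂ (deriv φ) := fun w =>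
    (hφ.analyticAt w).deriv.differentiableAt
  obtain ⟨c, hc⟩ := hφ'.exists_const_forall_eq_of_bounded
    (isBounded_iff_forall_norm_le.2 ⟨4 * C, by rintro _ ⟨w, rfl⟩; exact hbd w⟩)
  rw [hc]
  by_contra hc0
  have hlin : ∀ w, φ w - c * w = φ 0 - c * 0 := fun w =>
    is_const_of_deriv_eq_zero (hφ.sub (differentiable_id.const_mul c)) (fun w => by
      have := (hφ w).hasDerivAt.sub ((hasDerivAt_id w).const_mul c)
      rw [hc w] at this
      simpa using this.deriv) w 0
  have hz0 : φ (-φ 0 / c) = 0 := by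
    have := hlin (-φ 0 / c)
    rw [mul_div_cancel₀ _ hc0] at this
    linear_combination this
  exact hc0 ((hc _).symm.trans (h0 _ hz0))

/-- An entire function of bounded spherical derivative which omits the value `b` and is totally
ramified over `a ≠ b` is constant. -/
theorem deriv_eq_zero_of_omits_of_ramified {g : ℂ → ℂ} (hg : Differentiable ℂ g) {a b : ℂ}
    (hba : b ≠ a) (hb : ∀ z, g z ≠ b) (ha : ∀ z, g z = a → deriv g z = 0) {M : ℝ}
    (hM : ∀ z, ‖deriv g z‖ ≤ M * (1 + ‖g z‖ ^ 2)) (z : ℂ) : deriv g z = 0 := by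
  have hab : a - b ≠ 0 := sub_ne_zero.2 hba.symm
  have hgb : ∀ z, g z - b ≠ 0 := fun z => sub_ne_zero.2 (hb z)
  have hg' : Differentiable ℂ (deriv g) := fun w => (hg.analyticAt w).deriv.differentiableAt
  -- φ is a primitive of g'/(g - b), normalised at 0 to be a logarithm of (g - b)/(a - b).
  obtain ⟨φ, hφ0, hφ⟩ := (hg'.fun_div (hg.sub_const b) hgb).isExactOn_univ.with_val_at 0
    (Complex.log ((g 0 - b) / (a - b)))
  replace hφ := fun w => hφ w (Set.mem_univ w)
  have hφd : Differentiable ℂ φ := fun w => (hφ w).differentiableAt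
  have hexp : ∀ w, g w - b = (a - b) * Complex.exp (φ w) := by
    intro w
    have hder : ∀ w, HasDerivAt (fun w => (g w - b) * Complex.exp (-φ w)) 0 w := fun w => by
      have h1 := ((hg w).hasDerivAt.sub_const b).mul ((hφ w).fun_neg.cexp)
      refine h1.congr_deriv ?_
      linear_combination -Complex.exp (-φ w) * mul_div_cancel₀ (deriv g w) (hgb w)
    have h2 := is_const_of_deriv_eq_zero (fun w => (hder w).differentiableAt)
      (fun w => (hder w).deriv) w 0
    simp only [hφ0, Complex.exp_neg, Complex.exp_log (div_ne_zero (hgb 0) hab)] at h2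
    have h3 := hgb 0
    have h4 := Complex.exp_ne_zero (φ w)
    field_simp at h2
    linear_combination h2
  have key := deriv_eq_zero_of_norm_deriv_le_of_re_eq_zero hφd
    (C := |M| * (1 + (‖a - b‖ + ‖b‖) ^ 2) / ‖a - b‖) (fun w hw => ?_) (by positivity)
    (fun w hw => ?_) z
  · rw [(hφ z).deriv] at key
    simpa [hgb z] using key
  · have h1 : ‖g w - b‖ = ‖a - b‖ := by
      rw [hexp, norm_mul, Complex.norm_exp, hw, Real.exp_zero, mul_one]
    rw [(hφ w).deriv, norm_div, h1]
    gcongr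
    refine (hM w).trans ?_
    have h2 : ‖g w‖ ≤ ‖a - b‖ + ‖b‖ := by
      rw [← h1]
      simpa using norm_add_le (g w - b) b
    gcongr
    exact le_abs_self M
  · have h1 := hexp w
    rw [hw, Complex.exp_zero, mul_one] at h1
    rw [(hφ w).deriv, ha w (sub_left_injective h1), zero_div]

/-! ### Zalcman rescaling and the contradiction -/

/-- Zalcman's rescaling: near a point where the spherical derivative is large there is a point
around which `f`, rescaled by `ρ`, has spherical derivative `1` at the centre and at most `2` on a
large disc. -/
theorem exists_rescaling {f : ℂ → ℂ} {U : Set ℂ} (hU : IsOpen U) (hf : DifferentiableOn ℂ f U)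
    {z w : ℂ} {r P : ℝ} (hrU : Metric.closedBall z r ⊆ U) (hw : w ∈ Metric.closedBall z r)
    (hP : 0 < P) (hPw : P * (1 + ‖f w‖ ^ 2) ≤ (r - dist w z) * ‖deriv f w‖) :
    ∃ x : ℂ, ∃ ρ : ℝ, 0 < ρ ∧ ρ * P ≤ r ∧ ρ * ‖deriv f x‖ = 1 + ‖f x‖ ^ 2 ∧
      ∀ ζ : ℂ, ‖ζ‖ ≤ P / 2 → x + ρ * ζ ∈ Metric.closedBall z r ∧
        ρ * ‖deriv f (x + ρ * ζ)‖ ≤ 2 * (1 + ‖f (x + ρ * ζ)‖ ^ 2) := by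
  have hpos : ∀ x, 0 < 1 + ‖f x‖ ^ 2 := fun x => by positivity
  set s : ℂ → ℝ := fun x => ‖deriv f x‖ / (1 + ‖f x‖ ^ 2) with hs
  have hs0 : ∀ x, 0 ≤ s x := fun x => by positivity
  have hcont : ContinuousOn (fun x => (r - dist x z) * s x) (Metric.closedBall z r) := by
    intro x hx
    have h1 := (hf.analyticAt (hU.mem_nhds (hrU hx)))
    exact ((continuousAt_const.sub (continuousAt_id.dist continuousAt_const)).mul
      (h1.deriv.continuousAt.norm.div ((h1.continuousAt.norm.pow 2).const_add 1)
        (hpos x).ne')).continuousWithinAt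
  -- The centre maximises the spherical derivative weighted by the distance to the boundary; ρ is
  -- the reciprocal of the spherical derivative there.
  obtain ⟨x, hx, hmax⟩ := (isCompact_closedBall z r).exists_isMaxOn ⟨w, hw⟩ hcont
  have hmax' : ∀ y ∈ Metric.closedBall z r, (r - dist y z) * s y ≤ (r - dist x z) * s x :=
    fun y hy => hmax hy
  have hPx : P ≤ (r - dist x z) * s x := by
    refine le_trans ?_ (hmax' w hw)
    rwa [hs, ← mul_div_assoc, le_div_iff₀ (hpos w)]
  have hxr : 0 ≤ r - dist x z := sub_nonneg.2 hx
  have hsx : 0 < s x := by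
    refine (hs0 x).lt_of_ne fun h => ?_
    rw [← h, mul_zero] at hPx
    linarith
  have hρ : 0 < (s x)⁻¹ := inv_pos.2 hsx
  have hρP : (s x)⁻¹ * P ≤ r - dist x z := by
    rwa [inv_mul_le_iff₀ hsx, mul_comm]
  refine ⟨x, (s x)⁻¹, hρ, hρP.trans (by linarith [dist_nonneg (x := x) (y := z)]), ?_,
    fun ζ hζ => ?_⟩
  · have h1 : ‖deriv f x‖ = s x * (1 + ‖f x‖ ^ 2) := by
      simp only [hs]; rw [div_mul_cancel₀ _ (hpos x).ne']
    rw [h1, ← mul_assoc, inv_mul_cancel₀ hsx.ne', one_mul]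
  · set y := x + ((s x)⁻¹ : ℝ) * ζ with hy
    -- Moving at most half-way to the boundary at most halves the weight, so maximality gives s y ≤
    -- 2 s x.
    have hyx : dist y x ≤ (r - dist x z) / 2 := by
      rw [hy, dist_eq_norm, add_sub_cancel_left, norm_mul, Complex.norm_real,
        Real.norm_of_nonneg hρ.le]
      have := mul_le_mul_of_nonneg_left hζ hρ.le
      linarith
    have hyz := dist_triangle y x z
    have hyr : y ∈ Metric.closedBall z r := by
      rw [Metric.mem_closedBall]; linarith
    refine ⟨hyr, ?_⟩
    have h1 := hmax' y hyr
    have hxr' : 0 < r - dist x z := by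
      refine hxr.lt_of_ne fun h => ?_
      rw [← h, zero_mul] at hPx
      linarith
    have h2 : s y ≤ 2 * s x := by
      refine le_of_mul_le_mul_left ?_ hxr'
      have h3 : (r - dist x z) / 2 * s y ≤ (r - dist y z) * s y := by
        have := hs0 y
        gcongr
        linarith
      linarith
    have h3 : ‖deriv f y‖ = s y * (1 + ‖f y‖ ^ 2) := by
      simp only [hs]; rw [div_mul_cancel₀ _ (hpos y).ne']
    rw [h3, inv_mul_le_iff₀ hsx]
    have := mul_le_mul_of_nonneg_right h2 (hpos y).le
    linarith

/-- A sequence tending to infinity cannot keep spherical derivative `≥ 1` at a point. -/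
theorem not_tendstoInfty_of_le_norm_deriv {v : ℕ → ℂ → ℂ} {z : ℂ} {r : ℝ} (hr : 0 < r)
    (hv : ∀ᶠ n in atTop, DifferentiableOn ℂ (v n) (Metric.ball z r))
    (h1 : ∀ n, 1 + ‖v n z‖ ^ 2 ≤ ‖deriv (v n) z‖) :
    ¬ TendstoInftyLocallyUniformlyOn v Set.univ := by
  intro h
  obtain ⟨t, ht, ht0⟩ := h 0 z (Set.mem_univ z)
  rw [nhdsWithin_univ] at ht
  obtain ⟨δ, hδ, hδt⟩ := Metric.mem_nhds_iff.1 (inter_mem ht (Metric.ball_mem_nhds z hr))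
  have hd : ∀ᶠ n in atTop, DifferentiableOn ℂ (fun w => (v n w)⁻¹) (Metric.ball z δ) := by
    filter_upwards [hv, ht0] with n hn hn0
    exact (hn.mono fun w hw => (hδt hw).2).inv fun w hw => norm_pos_iff.1 (hn0 w (hδt hw).1)
  have hlim : TendstoLocallyUniformlyOn (fun n w => (v n w)⁻¹) (fun _ => 0) atTop
      (Metric.ball z δ) := by
    refine Metric.tendstoLocallyUniformlyOn_iff.2 fun ε hε x hx => ?_
    obtain ⟨t, ht, htn⟩ := h ε⁻¹ x (Set.mem_univ x)
    rw [nhdsWithin_univ] at ht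
    refine ⟨t, mem_nhdsWithin_of_mem_nhds ht, htn.mono fun n hn w hw => ?_⟩
    rw [dist_zero_left, norm_inv]
    exact inv_lt_of_inv_lt₀ hε (hn w hw)
  -- The derivatives of 1/v n tend to 0 at z, yet their moduli |v n'|/|v n|² are at least (1 + |v
  -- n|²)/|v n|² > 1.
  have h2 := ((hlim.deriv hd Metric.isOpen_ball).tendsto_at (Metric.mem_ball_self hδ)).norm
  rw [deriv_const, norm_zero] at h2
  obtain ⟨n, hn, hn0, hn1⟩ := ((h2.eventually (gt_mem_nhds one_pos)).and (ht0.and hv)).exists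
  have hz0 : v n z ≠ 0 := norm_pos_iff.1 (hn0 z (hδt (Metric.mem_ball_self hδ)).1)
  have hdz := (hn1.differentiableAt (Metric.ball_mem_nhds z hr)).hasDerivAt.fun_inv hz0
  simp only [Function.comp_apply] at hn
  have hsq : 0 < ‖v n z‖ ^ 2 := by positivity
  rw [hdz.deriv, norm_div, norm_neg, norm_pow, div_lt_one hsq] at hn
  linarith [h1 n]

/-- A rescaled sequence as produced by `exists_rescaling` cannot satisfy the two sharing
conditions asymptotically. -/
theorem false_of_rescaled_sharing {v : ℕ → ℂ → ℂ} {P ρ : ℕ → ℝ} {a b : ℂ} {B : ℝ} (hba : b ≠ a)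
    (hb0 : b ≠ 0) (hP : Tendsto P atTop atTop) (hρ : ∀ n, 0 < ρ n) (hρ0 : Tendsto ρ atTop (𝓝 0))
    (hv : ∀ n ζ, ‖ζ‖ ≤ P n → DifferentiableAt ℂ (v n) ζ ∧
      ‖deriv (v n) ζ‖ ≤ 2 * (1 + ‖v n ζ‖ ^ 2))
    (h0 : ∀ n, ‖deriv (v n) 0‖ = 1 + ‖v n 0‖ ^ 2)
    (ha : ∀ n ζ, ‖ζ‖ ≤ P n → v n ζ = a → ‖deriv (v n) ζ‖ ≤ ρ n * B)
    (hb : ∀ n ζ, ‖ζ‖ ≤ P n → v n ζ = b → deriv (v n) ζ = ρ n * b) : False := by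
  have hball : ∀ ζ₀ : ℂ, ∀ᶠ n in atTop, ∀ ζ ∈ Metric.ball ζ₀ 1, ‖ζ‖ ≤ P n := fun ζ₀ => by
    filter_upwards [hP.eventually_ge_atTop (‖ζ₀‖ + 1)] with n hn ζ hζ
    have h1 := norm_sub_norm_le ζ ζ₀
    rw [Metric.mem_ball, dist_eq_norm] at hζ
    linarith
  have hloc : HasLocallyBoundedSphericalDeriv v Set.univ := fun ζ₀ _ =>
    ⟨1, one_pos, 2, (hball ζ₀).mono fun n hn ζ hζ => hv n ζ (hn ζ hζ)⟩
  obtain ⟨φ, hφ, hlim⟩ := hloc.exists_subseq isOpen_univ isConnected_univ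
  have hφt := hφ.tendsto_atTop
  have hdiff : ∀ ζ₀ : ℂ, ∀ᶠ n in atTop, DifferentiableOn ℂ (v (φ n)) (Metric.ball ζ₀ 1) := fun ζ₀ =>
    (hφt.eventually (hball ζ₀)).mono fun n hn ζ hζ =>
      (hv _ ζ (hn ζ hζ)).1.differentiableWithinAt
  rcases hlim with ⟨g, hg, hlim⟩ | hinf
  · rw [differentiableOn_univ] at hg
    have hlimb := fun ζ₀ : ℂ => hlim.mono (Set.subset_univ (Metric.ball ζ₀ 1))
    have hmem := fun ζ₀ : ℂ => Metric.mem_ball_self (x := ζ₀) one_pos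
    have hderiv : ∀ ζ, Tendsto (fun n => deriv (v (φ n)) ζ) atTop (𝓝 (deriv g ζ)) := fun ζ =>
      ((hlimb ζ).deriv (hdiff ζ) Metric.isOpen_ball).tendsto_at (hmem ζ)
    have hval : ∀ ζ, Tendsto (fun n => v (φ n) ζ) atTop (𝓝 (g ζ)) := fun ζ =>
      hlim.tendsto_at (Set.mem_univ ζ)
    have hg0 : ‖deriv g 0‖ = 1 + ‖g 0‖ ^ 2 :=
      tendsto_nhds_unique (hderiv 0).norm
        ((((hval 0).norm.pow 2).const_add 1).congr fun n => (h0 (φ n)).symm)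
    have hgM : ∀ ζ, ‖deriv g ζ‖ ≤ 2 * (1 + ‖g ζ‖ ^ 2) := fun ζ =>
      le_of_tendsto_of_tendsto (hderiv ζ).norm ((((hval ζ).norm.pow 2).const_add 1).const_mul 2)
        ((hφt.eventually (hball ζ)).mono fun n hn => (hv _ ζ (hn ζ (hmem ζ))).2)
    have hρφ : Tendsto (fun n => ρ (φ n)) atTop (𝓝 0) := hρ0.comp hφt
    have hgb : ∀ ζ, g ζ ≠ b := by
      intro ζ hζ
      have hev := eventually_eq_of_deriv_eq_of_tendsto Metric.isOpen_ball (hmem ζ) (hlimb ζ)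
        (hdiff ζ) (c := fun n => ρ (φ n) * b)
        (fun n => mul_ne_zero (mod_cast (hρ _).ne') hb0)
        (by simpa using ((Complex.continuous_ofReal.tendsto 0).comp hρφ).mul_const b)
        ((hφt.eventually (hball ζ)).mono fun n hn w hw => hb _ w (hn w hw)) hζ
      have heq : g = fun _ => b := AnalyticOnNhd.eq_of_eventuallyEq
        (fun x _ => hg.analyticAt x) (fun x _ => analyticAt_const) hev
      rw [heq, deriv_const, norm_zero] at hg0
      linarith [sq_nonneg ‖b‖]
    have hga : ∀ ζ, g ζ = a → deriv g ζ = 0 := fun ζ hζ =>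
      deriv_eq_zero_of_norm_deriv_le_of_tendsto Metric.isOpen_ball (hmem ζ) (hlimb ζ) (hdiff ζ)
        (c := fun n => ρ (φ n) * B) (by simpa using hρφ.mul_const B)
        ((hφt.eventually (hball ζ)).mono fun n hn w hw => ha _ w (hn w hw)) hζ
    have h1 := deriv_eq_zero_of_omits_of_ramified hg hba hgb hga hgM 0
    rw [h1, norm_zero] at hg0
    linarith [sq_nonneg ‖g 0‖]
  · exact not_tendstoInfty_of_le_norm_deriv one_pos (hdiff 0) (fun n => (h0 (φ n)).ge) hinf

/-- A family sharing `a` and `b` with its derivatives in the sense of the main theorem has locally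
bounded spherical derivatives. -/
theorem exists_norm_deriv_le_of_sharing {D : Set ℂ} (hD : IsOpen D) {F : Set (ℂ → ℂ)}
    (hF : ∀ f ∈ F, DifferentiableOn ℂ f D) {a b : ℂ} (hba : b ≠ a) (hb0 : b ≠ 0) {B : ℝ}
    (hfa : ∀ f ∈ F, ∀ z ∈ D, f z = a → ‖deriv f z‖ ≤ B)
    (hfb : ∀ f ∈ F, ∀ z ∈ D, f z = b → deriv f z = b) {z : ℂ} (hz : z ∈ D) :
    ∃ r > 0, Metric.ball z r ⊆ D ∧ ∃ M : ℝ, ∀ f ∈ F, ∀ w ∈ Metric.ball z r,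
      ‖deriv f w‖ ≤ M * (1 + ‖f w‖ ^ 2) := by
  obtain ⟨r, hr, hrD⟩ := Metric.nhds_basis_closedBall.mem_iff.1 (hD.mem_nhds hz)
  by_contra! hcon
  -- Bad points are taken in the half-radius disc, at distance at least r/2 from the boundary. With
  -- M = n + 1 this gives P = (r/2)(n + 1) > 0 in the rescaling.
  choose f hf w hw hfw using hcon (r / 2) (by positivity)
    ((Metric.ball_subset_ball (by linarith)).trans (Metric.ball_subset_closedBall.trans hrD))
  have hPpos : ∀ n : ℕ, 0 < r / 2 * ((n : ℝ) + 1) := fun n => by positivity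
  have key := fun n : ℕ => exists_rescaling hD (hF _ (hf ((n : ℝ) + 1))) hrD
    (Metric.ball_subset_closedBall (Metric.ball_subset_ball (by linarith) (hw ((n : ℝ) + 1))))
    (hPpos n) (by
      have h1 : r / 2 ≤ r - dist (w ((n : ℝ) + 1)) z := by
        have := Metric.mem_ball.1 (hw ((n : ℝ) + 1))
        linarith
      rw [mul_assoc]
      exact mul_le_mul h1 (hfw _).le (by positivity) (by linarith))
  choose x ρ hρ hρP h1 h2 using key
  have hP : Tendsto (fun n : ℕ => r / 2 * ((n : ℝ) + 1)) atTop atTop :=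
    (tendsto_natCast_atTop_atTop.atTop_add tendsto_const_nhds).const_mul_atTop (by positivity)
  have hder : ∀ (n : ℕ) (ζ : ℂ), ‖ζ‖ ≤ r / 2 * ((n : ℝ) + 1) / 2 →
      HasDerivAt (fun ζ => f ((n : ℝ) + 1) (x n + ρ n * ζ))
        (ρ n * deriv (f ((n : ℝ) + 1)) (x n + ρ n * ζ)) ζ := fun n ζ hζ => by
    have h3 : HasDerivAt (fun ζ => x n + ρ n * ζ) (ρ n : ℂ) ζ := by
      simpa using ((hasDerivAt_id ζ).const_mul (ρ n : ℂ)).const_add (x n)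
    rw [mul_comm]
    exact ((hF _ (hf _)).differentiableAt
      (hD.mem_nhds (hrD (h2 n ζ hζ).1))).hasDerivAt.comp ζ h3
  have hnorm : ∀ (n : ℕ) (c : ℂ), ‖(ρ n : ℂ) * c‖ = ρ n * ‖c‖ := fun n c => by
    rw [norm_mul, Complex.norm_real, Real.norm_of_nonneg (hρ n).le]
  refine false_of_rescaled_sharing (v := fun n ζ => f ((n : ℝ) + 1) (x n + ρ n * ζ))
    (P := fun n => r / 2 * ((n : ℝ) + 1) / 2) (ρ := ρ) (B := B) hba hb0
    (hP.atTop_div_const two_pos) hρ ?_ (fun n ζ hζ => ⟨(hder n ζ hζ).differentiableAt, ?_⟩)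
    (fun n => ?_) (fun n ζ hζ h => ?_) (fun n ζ hζ h => ?_)
  · refine squeeze_zero (fun n => (hρ n).le) (fun n => (le_div_iff₀ (hPpos n)).2 (hρP n)) ?_
    exact tendsto_const_nhds.div_atTop hP
  · rw [(hder n ζ hζ).deriv, hnorm]
    exact (h2 n ζ hζ).2
  · rw [(hder n 0 (by rw [norm_zero]; linarith [hPpos n])).deriv, hnorm]
    simpa using h1 n
  · rw [(hder n ζ hζ).deriv, hnorm]
    have := hfa _ (hf _) _ (hrD (h2 n ζ hζ).1) h
    have := (hρ n).le
    gcongr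
  · rw [(hder n ζ hζ).deriv, hfb _ (hf _) _ (hrD (h2 n ζ hζ).1) h]

theorem theorem3p1 (D : Set ℂ) (hDo : IsOpen D) (hDc : IsConnected D)
    (F : Set (ℂ → ℂ)) (hF : ∀ f ∈ F, DifferentiableOn ℂ f D)
    (a b : ℂ) (hba : b ≠ a) (hb0 : b ≠ 0)
    (K : Set ℂ) (hK : IsCompact K) (hbK : b ∉ K)
    (hfa : ∀ f ∈ F, ∀ z₀ ∈ D, f z₀ = a → deriv f z₀ ∈ K)
    (hfb : ∀ f ∈ F, ∀ z₀ ∈ D, f z₀ = b → deriv f z₀ = b) :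
    IsNormalFamilyOn F D := by
  obtain ⟨B, hB⟩ := hK.isBounded.exists_norm_le
  intro u hu
  refine HasLocallyBoundedSphericalDeriv.exists_subseq (fun z hz => ?_) hDo hDc
  obtain ⟨r, hr, hrD, M, hM⟩ := exists_norm_deriv_le_of_sharing hDo hF hba hb0
    (fun f hf z hz h => hB _ (hfa f hf z hz h)) hfb hz
  exact ⟨r, hr, M, Eventually.of_forall fun n w hw =>
    ⟨(hF _ (hu n)).differentiableAt (hDo.mem_nhds (hrD hw)), hM _ (hu n) w hw⟩⟩
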